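/- Let $\mathbb N=\{1,2,\dots\}$ and let $\eta\in\{0,1\}^{\mathbb N}$ be a ball configuration with $\sum_{x}\eta(x)<\infty$. *Matching points.* Define $\mathcal W_k:\mathbb Z_{\ge 0}\to\{0,1\}$, $k\in\mathbb N$, by $\mathcal W_k(0)=0$ and $$\mathcal W_k(x)=\mathcal W_k(x-1)+\eta(x)\,(1-\mathcal W_k(x-1))\prod_{\ell=1}^{k-1}\mathcal W_\ell(x-1)-(1-\eta(x))\,\mathcal W_k(x-1)\prod_{\ell=1}^{k-1}(1-\mathcal W_\ell(x-1)),$$ and put $\eta^{\uparrow}_k(x)=\mathbf 1_{\{\mathcal W_k(x)>\mathcal W_k(x-1)\}}$, $\eta^{\downarrow}_k(x)=\mathbf 1_{\{\mathcal W_k(x)<\mathcal W_k(x-1)\}}$, $m^\sigma_k(x)=\sum_{y=1}^x\bigl(\eta^\sigma_k(y)-\eta^\sigma_{k+1}(y)\bigr)$ for $\sigma\in\{\uparrow,\downarrow\}$, and, for $j\in\mathbb N$, $$\tau_k(j)=\min\{x\in\mathbb Z_{\ge 0}: m^{\uparrow}_k(x)\ge j\text{ and }m^{\downarrow}_k(x)\ge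 j\}\qquad(\min\emptyset=\infty).$$ *Solitons.* The $k$-solitons of $\eta$ are the sets of $2k$ sites identified by the Takahashi–Satsuma (TS) algorithm: all sites $x\le 0$ are regarded as vacant ($\eta(x)=0$), so that the zeros to the left of the first ball belong to a run of infinite length, where a run is a maximal string of consecutive equal letters. As long as there are uncrossed 1's, consider only the uncrossed sites, select the leftmost run that has a preceding run and is at least as long as it, let $k$ be the length of that preceding run, identify as a $k$-soliton the first $k$ letters of the selected run together with the last $k$ letters of the preceding run, and cross out these $2k$ sites. **Proposition.** For every $k\in\mathbb N$ and $x\in\mathbb N$: $x$ is the rightmost component of some $k$-soliton of $\eta$ if and only if $x=\tau_k(j)$ for some $j\in\mathbb N$. -/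

import Mathlib

namespace BBS

/-- Finite ball configurations on the sites `1, 2, 3, …` (`true` is a ball, `false` an empty box).
Site `0` is always vacant. -/
def FiniteConfig : Set (ℕ → Bool) :=
  {η | η 0 = false ∧ {x : ℕ | η x = true}.Finite}

/-! ### The carrier with seat numbers -/

/-- The number of balls (`0` or `1`) at site `x`. -/
def ball (η : ℕ → Bool) (x : ℕ) : ℤ := if η x = true then 1 else 0

/-- `seat η x k` is `𝓦ₖ(x)`: it is `1` if the seat number `k ≥ 1` of the carrier is occupied after
the carrier has visited site `x`, and `0` otherwise. -/
def seat (η : ℕ → Bool) : ℕ → ℕ → ℤ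
  | 0, _ => 0
  | x + 1, k =>
      seat η x k
        + ball η (x + 1) * (1 - seat η x k) * ∏ l ∈ Finset.Ico 1 k, seat η x l
        - (1 - ball η (x + 1)) * seat η x k * ∏ l ∈ Finset.Ico 1 k, (1 - seat η x l)

/-- The two possible moves of a ball: into the carrier or out of it. -/
inductive Dir
  | up
  | down

/-- The seat number configuration: `seatConfig η σ k x` is `1` if the site `x ≥ 1` is a
`(k, σ)`-seat, and `0` otherwise. -/
def seatConfig (η : ℕ → Bool) : Dir → ℕ → ℕ → ℤ
  | .up, k, x => if seat η (x - 1) k < seat η x k then 1 else 0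
  | .down, k, x => if seat η x k < seat η (x - 1) k then 1 else 0

/-- `m^σ_k(x)`: the number of `(k, σ)`-seats minus the number of `(k + 1, σ)`-seats in `[1, x]`. -/
def seatDiff (η : ℕ → Bool) (σ : Dir) (k x : ℕ) : ℤ :=
  ∑ y ∈ Finset.Icc 1 x, (seatConfig η σ k y - seatConfig η σ (k + 1) y)

/-- The `j`-th leftmost matching point `τ_k(j)`, the least site `x` such that `m^σ_k(x) ≥ j` for
both `σ`. It is `∞` if there is no such site. -/
noncomputable def tau (η : ℕ → Bool) (k j : ℕ) : ℕ∞ :=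
  sInf ((fun x : ℕ => (x : ℕ∞)) '' {x : ℕ | ∀ σ : Dir, (j : ℤ) ≤ seatDiff η σ k x})

/-! ### The Takahashi–Satsuma algorithm -/

/-- The configuration as a two-sided word: all sites `z ≤ 0` are vacant, so that the zeros in front
of the first ball belong to a run of infinite length. -/
def letter (η : ℕ → Bool) (z : ℤ) : Bool := if 0 < z then η z.toNat else false

/-- `A` is a nonempty string of consecutive equal letters, among the sites outside the set `C` of
crossed out sites. -/
def IsConstString (η : ℕ → Bool) (C A : Set ℤ) : Prop :=
  A.Nonempty ∧ (∀ x ∈ A, x ∉ C) ∧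
    (∀ x ∈ A, ∀ y ∈ A, ∀ z, z ∉ C → x ≤ z → z ≤ y → z ∈ A) ∧
    (∀ x ∈ A, ∀ y ∈ A, letter η x = letter η y)

/-- A run of the uncrossed elements: a maximal string of consecutive equal letters. -/
def IsRun (η : ℕ → Bool) (C A : Set ℤ) : Prop := Maximal (IsConstString η C) A

/-- `A` lies to the left of `B`, and there is no further uncrossed site between them. -/
def Precedes (C A B : Set ℤ) : Prop :=
  (∀ a ∈ A, ∀ b ∈ B, a < b) ∧
    ∀ z, z ∉ C → (∃ a ∈ A, a ≤ z) → (∃ b ∈ B, z ≤ b) → z ∈ A ∪ B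

/-- `A` and `B` are consecutive runs and `B` is at least as long as `A`. -/
def IsCandidate (η : ℕ → Bool) (C A B : Set ℤ) : Prop :=
  IsRun η C A ∧ IsRun η C B ∧ Precedes C A B ∧ A.encard ≤ B.encard

/-- One scan of the algorithm when `C` is the set of crossed out sites: there is still an uncrossed
ball, `B` is the leftmost run which is at least as long as the run `A` preceding it, `A` has length
`k`, and `S` consists of the first `k` letters of `B` and of the last `k` letters of `A`
(that is, all of `A`). -/
def Identifies (η : ℕ → Bool) (C : Set ℤ) (k : ℕ) (S : Set ℤ) : Prop :=
  (∃ z, z ∉ C ∧ letter η z = true) ∧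
    ∃ A B F : Set ℤ,
      IsCandidate η C A B ∧
      (∀ A' B', IsCandidate η C A' B' → B' ≠ B → ∀ b ∈ B, ∀ b' ∈ B', b < b') ∧
      A.encard = k ∧
      F ⊆ B ∧ F.encard = k ∧ (∀ f ∈ F, ∀ b ∈ B, b ∉ F → f < b) ∧
      S = A ∪ F

/-- `C` is the set of crossed out sites after some number of iterations of the algorithm. -/
inductive Crossed (η : ℕ → Bool) : Set ℤ → Prop
  | start : Crossed η ∅
  | cross {C S : Set ℤ} {k : ℕ} : Crossed η C → Identifies η C k S → Crossed η (C ∪ S)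

/-- `S` is (the set of sites of) a `k`-soliton identified by the Takahashi–Satsuma algorithm. -/
def IsSoliton (η : ℕ → Bool) (k : ℕ) (S : Set ℤ) : Prop :=
  ∃ C, Crossed η C ∧ Identifies η C k S

end BBS

/-!
The algorithm of Takahashi and Satsuma can be run online. Scan the sites from left to right and
cross out a soliton as soon as its last site is read. Then the uncrossed sites scanned so far always
form a stack of runs whose lengths strictly decrease from left to right, starting with the infinite
run of zeros (`RunStack`). When the last run becomes as long as the one before it, both are
crossed out, and the stack shrinks by two runs. No run of the stack is at least as long as its
predecessor (`RunStack.not_isCandidate`), so the algorithm, which sees the whole configuration,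
selects just this pair of runs (`RunStack.identifies`). Its choice is unique
(`Identifies.unique`), and since the configuration is finite, the scan goes on until all balls are
crossed out (`ScanState.not_forall`). Hence the two procedures find the same solitons.

The stack is the same thing as the carrier: the seat `i` holds the letter of the last run with at
least `i` sites. Reading a letter `d` sets the first seat that differs from `d`. If the stack ends
with a run of length `a` followed by `b < a` letters `d`, this is the seat `b + 1`, and the
seat `b + 2` still differs from `d` exactly if `b + 1 < a`. So a `k`-soliton ends at a
site if and only if the seat `k` changes there and then agrees with the seat `k + 1`
(`Completes`, `ScanState.succ`, `exists_isSoliton_iff`).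

On the other hand `m^↑_k - m^↓_k = 𝓦_k - 𝓦_{k + 1}`, and the seat `k + 1` only changes to the value
of the seat `k`. It follows that the minimum of `m^↑_k` and `m^↓_k` grows by `1` at exactly these
sites and is constant otherwise (`matched_succ`), so they are the points `τ_k(j)`
(`exists_eq_tau_iff`).
-/

namespace BBS

/-! ### Seats as bits, and matching points -/

open Classical in
/-- Reading the letter `d` sets the first of the bits `f 1, f 2, …` that differs from `d`, so the
bit `i` becomes `d` as soon as all bits before it are `d`. -/
noncomputable def readLetter (d : Bool) (f : ℕ → Bool) (i : ℕ) : Bool :=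
  if ∀ l ∈ Finset.Ico 1 i, f l = d then d else f i

/-- The seats of the carrier as bits: `occupied η x i` says that the seat `i` is occupied after the
site `x`. -/
noncomputable def occupied (η : ℕ → Bool) : ℕ → ℕ → Bool
  | 0, _ => false
  | x + 1, i => readLetter (η (x + 1)) (occupied η x) i

theorem prod_bits (s : Finset ℕ) (p : ℕ → Bool) {v : ℕ → ℤ}
    (hv : ∀ l, v l = if p l = true then 1 else 0) :
    (∀ l ∈ s, p l = true) ∧ ∏ l ∈ s, v l = 1 ∨ (¬ ∀ l ∈ s, p l = true) ∧ ∏ l ∈ s, v l = 0 := by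
  by_cases h : ∀ l ∈ s, p l = true
  · exact .inl ⟨h, Finset.prod_eq_one fun l hl => by rw [hv, if_pos (h l hl)]⟩
  · refine .inr ⟨h, ?_⟩
    push Not at h
    obtain ⟨l, hl, hpl⟩ := h
    exact Finset.prod_eq_zero hl (by rw [hv, if_neg hpl])

theorem seat_eq_ite_occupied (η : ℕ → Bool) (x i : ℕ) :
    seat η x i = if occupied η x i = true then 1 else 0 := by
  induction x generalizing i with
  | zero => simp [seat, occupied]
  | succ x ih =>
    have h1 := prod_bits (Finset.Ico 1 i) (occupied η x) ih
    have h2 := prod_bits (Finset.Ico 1 i) (fun l => !occupied η x l) (v := fun l => 1 - seat η x l)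
      (fun l => by rw [ih]; cases occupied η x l <;> simp)
    simp only [Bool.not_eq_true'] at h2
    rw [seat, ih i, occupied, readLetter, ball]
    rcases h1 with ⟨h1, e1⟩ | ⟨h1, e1⟩ <;> rcases h2 with ⟨h2, e2⟩ | ⟨h2, e2⟩ <;>
      rw [e1, e2] <;> cases η (x + 1) <;> cases occupied η x i <;>
      first | rw [if_pos h1] | rw [if_neg h1] | rw [if_pos h2] | rw [if_neg h2]
    all_goals simp

/-- Reading the site `x + 1` changes the seat `k`, and afterwards the seats `k` and `k + 1` agree. -/
def Completes (η : ℕ → Bool) (k x : ℕ) : Prop :=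
  occupied η (x + 1) k ≠ occupied η x k ∧ occupied η (x + 1) (k + 1) = occupied η (x + 1) k

/-- If the seat `k + 1` changes, then it takes the value that the seat `k` had and keeps. -/
theorem occupied_succ_change {η : ℕ → Bool} {k x : ℕ} (hk : 1 ≤ k)
    (h : occupied η (x + 1) (k + 1) ≠ occupied η x (k + 1)) :
    occupied η x k = occupied η (x + 1) (k + 1) ∧
      occupied η (x + 1) k = occupied η (x + 1) (k + 1) := by
  rw [occupied, readLetter] at h
  split_ifs at h with h1
  · have h2 : ∀ l ∈ Finset.Ico 1 k, occupied η x l = η (x + 1) := fun l hl =>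
      h1 l (by simp only [Finset.mem_Ico] at hl ⊢; omega)
    have h3 : occupied η x k = η (x + 1) := h1 k (by simp only [Finset.mem_Ico]; omega)
    simp only [occupied, readLetter, if_pos h1, if_pos h2, h3, and_self]
  · exact absurd rfl h

/-- At most one seat changes at each site. -/
theorem Completes.unique {η : ℕ → Bool} {k k' x : ℕ} (hk : 1 ≤ k) (hk' : 1 ≤ k')
    (h : Completes η k x) (h' : Completes η k' x) : k = k' := by
  have key : ∀ a b : ℕ, 1 ≤ a → a < b → occupied η (x + 1) a ≠ occupied η x a →
      occupied η (x + 1) b ≠ occupied η x b → False := by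
    intro a b ha hab h1 h2
    rw [occupied, readLetter] at h1 h2
    split_ifs at h1 h2 with h3 h4
    · exact h1 (h4 a (by simp only [Finset.mem_Ico]; omega)).symm
    all_goals simp_all
  rcases lt_trichotomy k k' with hlt | heq | hgt
  · exact (key _ _ hk hlt h.1 h'.1).elim
  · exact heq
  · exact (key _ _ hk' hgt h'.1 h.1).elim

theorem seatDiff_succ (η : ℕ → Bool) (σ : Dir) (k x : ℕ) :
    seatDiff η σ k (x + 1)
      = seatDiff η σ k x + (seatConfig η σ k (x + 1) - seatConfig η σ (k + 1) (x + 1)) := by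
  rw [seatDiff, Finset.sum_Icc_succ_top (by omega), ← seatDiff]

theorem seatDiff_up_sub_down (η : ℕ → Bool) (k x : ℕ) :
    seatDiff η .up k x - seatDiff η .down k x = seat η x k - seat η x (k + 1) := by
  induction x with
  | zero => simp [seatDiff, seat]
  | succ x ih =>
    simp only [seatDiff_succ, seatConfig, Nat.add_sub_cancel]
    have e : ∀ i, (if seat η x i < seat η (x + 1) i then (1 : ℤ) else 0)
        - (if seat η (x + 1) i < seat η x i then 1 else 0) = seat η (x + 1) i - seat η x i := by
      intro i
      simp only [seat_eq_ite_occupied]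
      cases occupied η x i <;> cases occupied η (x + 1) i <;> simp
    linarith [e k, e (k + 1)]

/-- The number of matching points up to `x`: the minimum of `m^σ_k(x)` over both directions. -/
def matched (η : ℕ → Bool) (k x : ℕ) : ℤ := min (seatDiff η .up k x) (seatDiff η .down k x)

open Classical in
/-- A change of the seat `k + 1` only lowers the larger one of the two differences, so
their minimum never decreases. -/
theorem matched_succ (η : ℕ → Bool) {k : ℕ} (hk : 1 ≤ k) (x : ℕ) :
    matched η k (x + 1) = matched η k x + if Completes η k x then 1 else 0 := by
  have h := seatDiff_up_sub_down η k x
  have hc := occupied_succ_change (η := η) (x := x) hk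
  have hite : (if Completes η k x then (1 : ℤ) else 0)
      = if (occupied η (x + 1) k != occupied η x k &&
          occupied η (x + 1) (k + 1) == occupied η (x + 1) k) = true then 1 else 0 := by
    refine if_congr ?_ rfl rfl
    simp only [Completes, Bool.and_eq_true, bne_iff_ne, beq_iff_eq]
  rw [hite]
  simp only [matched, seatDiff_succ, seatConfig, Nat.add_sub_cancel]
  simp only [seat_eq_ite_occupied] at h ⊢
  revert h hc
  generalize seatDiff η .up k x = u
  generalize seatDiff η .down k x = v
  cases occupied η x k <;> cases occupied η (x + 1) k <;> cases occupied η x (k + 1) <;>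
    cases occupied η (x + 1) (k + 1) <;> simp <;> intro h <;> omega

theorem matched_mono (η : ℕ → Bool) {k : ℕ} (hk : 1 ≤ k) : Monotone (matched η k) := by
  refine monotone_nat_of_le_succ fun x => ?_
  rw [matched_succ η hk]
  split_ifs <;> omega

theorem le_matched_iff (η : ℕ → Bool) (k j x : ℕ) :
    (j : ℤ) ≤ matched η k x ↔ ∀ σ : Dir, (j : ℤ) ≤ seatDiff η σ k x := by
  rw [matched, le_min_iff]
  refine ⟨fun h σ => ?_, fun h => ⟨h _, h _⟩⟩
  cases σ
  exacts [h.1, h.2]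

theorem exists_eq_tau_iff (η : ℕ → Bool) {k : ℕ} (hk : 1 ≤ k) (x : ℕ) :
    (∃ j : ℕ, 1 ≤ j ∧ ((x + 1 : ℕ) : ℕ∞) = tau η k j) ↔ Completes η k x := by
  simp only [tau, ← le_matched_iff]
  constructor
  · rintro ⟨j, -, h⟩
    have hne : {y : ℕ | (j : ℤ) ≤ matched η k y}.Nonempty := by
      by_contra hne
      rw [Set.not_nonempty_iff_eq_empty] at hne
      simp [hne] at h
    rw [sInf_image, ← ENat.natCast_sInf hne, Nat.cast_inj] at h
    have h1 : (j : ℤ) ≤ matched η k (x + 1) := by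
      have := Nat.sInf_mem hne
      rwa [← h] at this
    have h2 : ¬ (j : ℤ) ≤ matched η k x := fun hx => by
      have := Nat.sInf_le (s := {y : ℕ | (j : ℤ) ≤ matched η k y}) hx
      omega
    by_contra hc
    rw [matched_succ η hk, if_neg hc] at h1
    omega
  · intro hc
    have h1 : matched η k (x + 1) = matched η k x + 1 := by rw [matched_succ η hk, if_pos hc]
    have h0 : 0 ≤ matched η k x := by
      have := matched_mono η hk (Nat.zero_le x)
      simpa [matched, seatDiff] using this
    obtain ⟨j, hj⟩ := Int.eq_ofNat_of_zero_le (show 0 ≤ matched η k (x + 1) by omega)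
    refine ⟨j, by omega, le_antisymm ?_ ?_⟩
    · refine le_sInf ?_
      rintro _ ⟨y, hy, rfl⟩
      rw [Set.mem_ofPred_eq] at hy
      rw [Nat.cast_le]
      by_contra hlt
      have := matched_mono η hk (show y ≤ x by omega)
      omega
    · exact sInf_le ⟨x + 1, hj.ge, rfl⟩

/-! ### Runs and the determinism of the algorithm -/

/-- A string of equal letters is a run if every uncrossed site outside it is separated
from it by a different letter. -/
theorem IsConstString.isRun {η : ℕ → Bool} {C R : Set ℤ} (h : IsConstString η C R)
    (hs : ∀ z, z ∉ C → z ∉ R → ∃ r ∈ R, ∃ w, w ∉ C ∧ letter η w ≠ letter η r ∧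
      (r ≤ w ∧ w ≤ z ∨ z ≤ w ∧ w ≤ r)) : IsRun η C R := by
  refine ⟨h, fun R' hR' hle z hz => ?_⟩
  by_contra hzR
  obtain ⟨r, hr, w, hwC, hne, hw⟩ := hs z (hR'.2.1 z hz) hzR
  have hrR' := hle hr
  refine hne (hR'.2.2.2 w ?_ r hrR')
  rcases hw with hw | hw
  · exact hR'.2.2.1 r hrR' z hz w hwC hw.1 hw.2
  · exact hR'.2.2.1 z hz r hrR' w hwC hw.1 hw.2

theorem IsRun.eq_of_mem {η : ℕ → Bool} {C R R' : Set ℤ} (h : IsRun η C R) (h' : IsRun η C R')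
    {z : ℤ} (hz : z ∈ R) (hz' : z ∈ R') : R = R' := by
  have hu : IsConstString η C (R ∪ R') := by
    refine ⟨⟨z, .inl hz⟩, ?_, ?_, ?_⟩
    · rintro a (ha | ha)
      exacts [h.1.2.1 a ha, h'.1.2.1 a ha]
    · have hc := h.1.2.2.1
      have hc' := h'.1.2.2.1
      -- the common point `z` splits every gap into two parts, each with both ends in one run
      rintro a (ha | ha) b (hb | hb) w hw h1 h2
      · exact .inl (hc a ha b hb w hw h1 h2)
      · rcases le_total w z with hwz | hwz
        · exact .inl (hc a ha z hz w hw h1 hwz)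
        · exact .inr (hc' z hz' b hb w hw hwz h2)
      · rcases le_total w z with hwz | hwz
        · exact .inr (hc' a ha z hz' w hw h1 hwz)
        · exact .inl (hc z hz b hb w hw hwz h2)
      · exact .inr (hc' a ha b hb w hw h1 h2)
    · have hl : ∀ a ∈ R ∪ R', letter η a = letter η z := by
        rintro a (ha | ha)
        exacts [h.1.2.2.2 a ha z hz, h'.1.2.2.2 a ha z hz']
      exact fun a ha b hb => (hl a ha).trans (hl b hb).symm
  exact (h.eq_of_subset hu Set.subset_union_left).trans
    (h'.eq_of_subset hu Set.subset_union_right).symm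

theorem IsRun.lt_or_lt {η : ℕ → Bool} {C R R' : Set ℤ} (h : IsRun η C R) (h' : IsRun η C R')
    (hne : R ≠ R') : (∀ r ∈ R, ∀ r' ∈ R', r < r') ∨ (∀ r ∈ R, ∀ r' ∈ R', r' < r) := by
  have hd : ∀ z ∈ R, z ∉ R' := fun z hz hz' => hne (h.eq_of_mem h' hz hz')
  by_contra! hcon
  obtain ⟨⟨r, hr, r', hr', h1⟩, s, hs, s', hs', h2⟩ := hcon
  have hc := h.1.2.2.1
  have hc' := h'.1.2.2.1
  have hrs : r' ∉ R := fun hz => hd _ hz hr'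
  have hss : s' ∉ R := fun hz => hd _ hz hs'
  -- `r' ≤ r` and `s ≤ s'`: compare `s` with `r'`
  rcases le_total s r' with h3 | h3
  · exact hrs (hc s hs r hr r' (h'.1.2.1 _ hr') h3 h1)
  · exact hd s hs (hc' r' hr' s' hs' s (h.1.2.1 _ hs) h3 h2)

theorem Precedes.eq_of_isRun {η : ℕ → Bool} {C A A' B : Set ℤ} (hA : IsRun η C A)
    (hA' : IsRun η C A') (hB : B.Nonempty) (h : Precedes C A B) (h' : Precedes C A' B) :
    A = A' := by
  obtain ⟨a, ha⟩ := hA.1.1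
  obtain ⟨a', ha'⟩ := hA'.1.1
  obtain ⟨b, hb⟩ := hB
  rcases le_total a a' with hle | hle
  · rcases h.2 a' (hA'.1.2.1 _ ha') ⟨a, ha, hle⟩ ⟨b, hb, (h'.1 _ ha' _ hb).le⟩ with hz | hz
    · exact hA.eq_of_mem hA' hz ha'
    · exact (lt_irrefl _ (h'.1 _ ha' _ hz)).elim
  · rcases h'.2 a (hA.1.2.1 _ ha) ⟨a', ha', hle⟩ ⟨b, hb, (h.1 _ ha _ hb).le⟩ with hz | hz
    · exact hA.eq_of_mem hA' ha hz
    · exact (lt_irrefl _ (h.1 _ ha _ hz)).elim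

/-- An initial segment of `B` is determined by its finite length. -/
theorem initialSegment_unique {B F F' : Set ℤ} {k : ℕ} (hF : F ⊆ B) (hFk : F.encard = k)
    (hFi : ∀ f ∈ F, ∀ b ∈ B, b ∉ F → f < b) (hF' : F' ⊆ B) (hFk' : F'.encard = k)
    (hFi' : ∀ f ∈ F', ∀ b ∈ B, b ∉ F' → f < b) : F = F' := by
  have hfin : F.Finite := Set.finite_of_encard_eq_coe hFk
  have hfin' : F'.Finite := Set.finite_of_encard_eq_coe hFk'
  by_cases hsub : F ⊆ F'
  · exact hfin.eq_of_subset_of_encard_le hsub (hFk'.trans hFk.symm).le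
  · obtain ⟨z, hz, hz'⟩ := Set.not_subset.1 hsub
    refine (hfin'.eq_of_subset_of_encard_le (fun f hf => ?_) (hFk.trans hFk'.symm).le).symm
    by_contra hfF
    exact lt_asymm (hFi z hz f (hF' hf) hfF) (hFi' f hf z (hF hz) hz')

theorem Identifies.unique {η : ℕ → Bool} {C S S' : Set ℤ} {k k' : ℕ} (h : Identifies η C k S)
    (h' : Identifies η C k' S') : k = k' ∧ S = S' := by
  obtain ⟨-, A, B, F, hc, hmin, hAk, hF, hFk, hFi, rfl⟩ := h
  obtain ⟨-, A', B', F', hc', hmin', hAk', hF', hFk', hFi', rfl⟩ := h'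
  obtain rfl : B = B' := by
    by_contra hne
    obtain ⟨b, hb⟩ := hc.2.1.1.1
    obtain ⟨b', hb'⟩ := hc'.2.1.1.1
    exact lt_asymm (hmin _ _ hc' (Ne.symm hne) b hb b' hb') (hmin' _ _ hc hne b' hb' b hb)
  obtain rfl := Precedes.eq_of_isRun hc.1 hc'.1 hc.2.1.1.1 hc.2.2.1 hc'.2.2.1
  obtain rfl : k = k' := by exact_mod_cast hAk.symm.trans hAk'
  exact ⟨rfl, by rw [initialSegment_unique hF hFk hFi hF' hFk' hFi']⟩

/-! ### Stacks of runs of decreasing lengths -/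

/-- `RunStack η U T c f`: the set of sites `U` is a word whose runs have strictly decreasing
lengths from left to right, the first of them being an infinite run of zeros. The last run is `T`,
of the letter `c`. The bits `f` encode the lengths: for `i ≥ 1`, `f i` is the letter of the last
run with at least `i` sites. -/
inductive RunStack (η : ℕ → Bool) : Set ℤ → Set ℤ → Bool → (ℕ → Bool) → Prop
  | base {R : Set ℤ} : R.encard = ⊤ → (∀ z ∈ R, letter η z = false) →
      RunStack η R R false (fun _ => false)
  | push {U A B : Set ℤ} {c : Bool} {f : ℕ → Bool} : RunStack η U A c f → B.Nonempty →
      (∀ b ∈ B, letter η b = !c) → (∀ u ∈ U, ∀ b ∈ B, u < b) → B.encard < A.encard →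
      RunStack η (U ∪ B) B (!c) (fun i => if (i : ℕ∞) ≤ B.encard then !c else f i)

namespace RunStack

variable {η : ℕ → Bool} {C U T : Set ℤ} {c : Bool} {f : ℕ → Bool}

theorem letter_eq (h : RunStack η U T c f) : ∀ t ∈ T, letter η t = c := by
  cases h <;> assumption

theorem nonempty (h : RunStack η U T c f) : T.Nonempty := by
  cases h with
  | base hinf _ => exact Set.nonempty_of_encard_ne_zero (by rw [hinf]; simp)
  | push _ hB => exact hB

theorem subset (h : RunStack η U T c f) : T ⊆ U := by
  cases h with
  | base => exact subset_rfl
  | push => exact Set.subset_union_right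

theorem mem_of_le (h : RunStack η U T c f) {t z : ℤ} (ht : t ∈ T) (hz : z ∈ U) (hle : t ≤ z) :
    z ∈ T := by
  cases h with
  | base => exact hz
  | push _ _ _ hlt _ =>
    rcases hz with hz | hz
    · exact absurd (hlt z hz t ht) (not_lt.2 hle)
    · exact hz

theorem bit_eq (h : RunStack η U T c f) {i : ℕ} (hi : (i : ℕ∞) ≤ T.encard) : f i = c := by
  cases h with
  | base => rfl
  | push => exact if_pos hi

/-- If `U` is an initial segment of the uncrossed sites and is followed by a letter other than
that of its last run `T`, then `T` is a run of the uncrossed sites. -/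
theorem isRun (h : RunStack η U T c f) (hUC : ∀ z ∈ U, z ∉ C)
    (hini : ∀ u ∈ U, ∀ z, z ∉ C → z ≤ u → z ∈ U)
    (hfol : ∀ z, z ∉ C → z ∉ U → ∃ w, w ∉ C ∧ w ∉ U ∧ w ≤ z ∧ letter η w = !c) :
    IsRun η C T := by
  refine IsConstString.isRun ⟨h.nonempty, fun z hz => hUC z (h.subset hz), ?_, ?_⟩ ?_
  · exact fun a ha b hb z hz h1 h2 => h.mem_of_le ha (hini b (h.subset hb) z hz h2) h1
  · exact fun a ha b hb => (h.letter_eq a ha).trans (h.letter_eq b hb).symm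
  · intro z hzC hzT
    obtain ⟨t, ht⟩ := h.nonempty
    refine ⟨t, ht, ?_⟩
    by_cases hzU : z ∈ U
    · have hzt : ∀ s ∈ T, z < s := fun s hs => not_le.1 fun hle => hzT (h.mem_of_le hs hzU hle)
      cases h with
      | base => exact absurd hzU hzT
      | push h' hB hlet hlt hcard =>
        rw [Set.mem_union, or_iff_left hzT] at hzU
        obtain ⟨a, ha⟩ := h'.nonempty
        have haU := h'.subset ha
        -- a site of the preceding run lies between `z` and `t`, unless `z` is itself one
        rcases le_total z a with hza | hza
        · refine ⟨a, hUC a (.inl haU), ?_, .inr ⟨hza, (hlt a haU t ht).le⟩⟩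
          rw [h'.letter_eq a ha, hlet t ht]
          simp
        · refine ⟨z, hzC, ?_, .inr ⟨le_rfl, (hzt t ht).le⟩⟩
          rw [h'.letter_eq z (h'.mem_of_le ha hzU hza), hlet t ht]
          simp
    · obtain ⟨w, hwC, hwU, hwz, hw⟩ := hfol z hzC hzU
      refine ⟨w, hwC, by rw [hw, h.letter_eq t ht]; simp, .inl ⟨?_, hwz⟩⟩
      exact (not_le.1 fun hle => hwU (hini t (h.subset ht) w hwC hle)).le

/-- Since the lengths decrease, no run inside of `U` is a candidate. -/
theorem not_isCandidate (h : RunStack η U T c f) (hUC : ∀ z ∈ U, z ∉ C)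
    (hini : ∀ u ∈ U, ∀ z, z ∉ C → z ≤ u → z ∈ U)
    (hfol : ∀ z, z ∉ C → z ∉ U → ∃ w, w ∉ C ∧ w ∉ U ∧ w ≤ z ∧ letter η w = !c)
    {A' B' : Set ℤ} (hB'U : B' ⊆ U) : ¬ IsCandidate η C A' B' := by
  induction h with
  | @base R hinf hR =>
    intro hcand
    have hrun := (RunStack.base hinf hR).isRun hUC hini hfol
    obtain ⟨a, ha⟩ := hcand.1.1.1
    obtain ⟨b, hb⟩ := hcand.2.1.1.1
    have hab := hcand.2.2.1.1 a ha b hb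
    have haR := hini b (hB'U hb) a (hcand.1.1.2.1 a ha) hab.le
    have hAR := hcand.1.eq_of_mem hrun ha haR
    exact lt_irrefl _ (hcand.2.2.1.1 b (hAR ▸ hB'U hb) b hb)
  | @push U A B c f h hB hlet hlt hcard ih =>
    intro hcand
    have hUC' : ∀ z ∈ U, z ∉ C := fun z hz => hUC z (.inl hz)
    have hini' : ∀ u ∈ U, ∀ z, z ∉ C → z ≤ u → z ∈ U := by
      intro u hu z hz hle
      rcases hini u (.inl hu) z hz hle with h1 | h1
      · exact h1
      · exact absurd (hlt u hu z h1) (not_lt.2 hle)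
    have hBU : ∀ b ∈ B, b ∉ U := fun b hb hbU => lt_irrefl _ (hlt b hbU b hb)
    have hfol' : ∀ z, z ∉ C → z ∉ U → ∃ w, w ∉ C ∧ w ∉ U ∧ w ≤ z ∧ letter η w = !c := by
      intro z hz hzU
      by_cases hzB : z ∈ B
      · exact ⟨z, hz, hzU, le_rfl, hlet z hzB⟩
      · obtain ⟨b, hb⟩ := hB
        refine ⟨b, hUC b (.inr hb), hBU b hb, ?_, hlet b hb⟩
        by_contra hle
        rcases hini b (.inr hb) z hz (not_le.1 hle).le with h1 | h1
        exacts [hzU h1, hzB h1]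
    have hrun := (RunStack.push h hB hlet hlt hcard).isRun hUC hini hfol
    have hrunA := h.isRun hUC' hini' hfol'
    by_cases hmeet : ∃ b ∈ B', b ∈ B
    · obtain ⟨b, hb', hb⟩ := hmeet
      obtain rfl := hcand.2.1.eq_of_mem hrun hb' hb
      have hprec : Precedes C A B' := by
        refine ⟨fun a ha b hb => hlt a (h.subset ha) b hb, ?_⟩
        rintro z hz ⟨a, ha, haz⟩ ⟨b, hb, hzb⟩
        rcases hini b (.inr hb) z hz hzb with h1 | h1
        · exact .inl (h.mem_of_le ha h1 haz)
        · exact .inr h1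
      obtain rfl := Precedes.eq_of_isRun hrunA hcand.1 hB hprec hcand.2.2.1
      exact absurd hcard (not_lt.2 hcand.2.2.2)
    · push Not at hmeet
      exact ih hUC' hini' hfol' (fun b hb => (hB'U hb).resolve_right (hmeet b hb)) hcand

end RunStack

/-- Any stack of runs is a stack ending with the letter other than `d`, followed by a shorter and
possibly empty string `B` of letters `d`, unless it consists of zeros only and `d` is zero. -/
theorem RunStack.top_split {η : ℕ → Bool} {U T : Set ℤ} {c : Bool} {f : ℕ → Bool}
    (h : RunStack η U T c f) (d : Bool) :
    (d = false ∧ U.encard = ⊤ ∧ (∀ z ∈ U, letter η z = false) ∧ f = fun _ => false) ∨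
    ∃ U' A B f', RunStack η U' A (!d) f' ∧ U = U' ∪ B ∧ (∀ b ∈ B, letter η b = d) ∧
      (∀ u ∈ U', ∀ b ∈ B, u < b) ∧ B.encard < A.encard ∧
      ∀ i : ℕ, 1 ≤ i → f i = if (i : ℕ∞) ≤ B.encard then d else f' i := by
  by_cases hcd : c = !d
  · subst hcd
    refine .inr ⟨U, T, ∅, f, h, by simp, by simp, by simp, ?_, fun i hi => ?_⟩
    · rw [Set.encard_empty, Set.encard_pos]
      exact h.nonempty
    · rw [Set.encard_empty, if_neg]
      simp only [nonpos_iff_eq_zero, Nat.cast_eq_zero]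
      omega
  · cases h with
    | base hinf hR =>
      left
      refine ⟨?_, hinf, hR, rfl⟩
      simpa using hcd
    | @push U A _ c f h hB hlet hlt hcard =>
      obtain rfl : c = !d := by cases c <;> cases d <;> simp_all
      refine .inr ⟨U, A, T, f, h, rfl, ?_, hlt, hcard, ?_⟩ <;> simp_all

/-- The effect of reading a letter `d` on bits `f` of which the first `n` are `d` and the next one is
not, if the bits after the first `n` are given by `f'`. -/
theorem bits_step {f f' : ℕ → Bool} {d : Bool} {n : ℕ}
    (hf : ∀ i : ℕ, 1 ≤ i → f i = if i ≤ n then d else f' i) (hn : f' (n + 1) = !d) {i : ℕ}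
    (hi : 1 ≤ i) :
    readLetter d f i = if i ≤ n + 1 then d else f' i := by
  rw [readLetter]
  by_cases hin : i ≤ n + 1
  · rw [if_pos hin, if_pos]
    intro l hl
    rw [Finset.mem_Ico] at hl
    rw [hf l hl.1, if_pos (by omega)]
  · rw [if_neg hin, if_neg, hf i hi, if_neg (by omega)]
    intro hall
    have := hall (n + 1) (by rw [Finset.mem_Ico]; omega)
    rw [hf _ (by omega), if_neg (by omega), hn] at this
    simp at this

/-- If the last run `A` of the stack `U` has length `k`, and it is followed by exactly `k - 1`
letters `d` in front of the site `y`, which has the letter `d` as well, then the algorithm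
identifies the `k`-soliton that ends at `y`, whatever the letters after `y` are. -/
theorem RunStack.identifies {η : ℕ → Bool} {C U A B : Set ℤ} {d : Bool} {f : ℕ → Bool} {y : ℤ}
    {k : ℕ} (h : RunStack η U A (!d) f) (hB : ∀ b ∈ B, letter η b = d)
    (hlt : ∀ u ∈ U, ∀ b ∈ B, u < b) (hU : ∀ z, z ∈ U ∪ B ↔ z ∉ C ∧ z < y)
    (hCy : ∀ z ∈ C, z < y) (hy : letter η y = d) (hA : A.encard = k)
    (hBk : (insert y B).encard = k) : Identifies η C k (A ∪ insert y B) := by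
  have hUC : ∀ z ∈ U, z ∉ C := fun z hz => ((hU z).1 (.inl hz)).1
  have hUy : ∀ z ∈ U, z < y := fun z hz => ((hU z).1 (.inl hz)).2
  have hBC : ∀ z ∈ B, z ∉ C := fun z hz => ((hU z).1 (.inr hz)).1
  have hBy : ∀ z ∈ B, z < y := fun z hz => ((hU z).1 (.inr hz)).2
  have hgC : ∀ z, y ≤ z → z ∉ C := fun z hz hzC => absurd (hCy z hzC) (not_lt.2 hz)
  have hini : ∀ u ∈ U, ∀ z, z ∉ C → z ≤ u → z ∈ U := by
    intro u hu z hz hle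
    rcases (hU z).2 ⟨hz, hle.trans_lt (hUy u hu)⟩ with h1 | h1
    · exact h1
    · exact absurd (hlt u hu z h1) (not_lt.2 hle)
  have hfol : ∀ z, z ∉ C → z ∉ U → ∃ w, w ∉ C ∧ w ∉ U ∧ w ≤ z ∧ letter η w = !!d := by
    intro z hz hzU
    rw [Bool.not_not]
    by_cases hzy : z < y
    · exact ⟨z, hz, hzU, le_rfl, hB z (((hU z).2 ⟨hz, hzy⟩).resolve_left hzU)⟩
    · exact ⟨y, hgC y le_rfl, fun hyU => lt_irrefl _ (hUy y hyU), not_lt.1 hzy, hy⟩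
  have hrunA : IsRun η C A := h.isRun hUC hini hfol
  obtain ⟨a₀, ha₀⟩ := h.nonempty
  have haU : ∀ a ∈ A, a ∈ U := fun a ha => h.subset ha
  have hla := h.letter_eq
  -- the full run that starts with `B` and `y`
  set R : Set ℤ := B ∪ {z | y ≤ z ∧ ∀ w, y ≤ w → w ≤ z → letter η w = d} with hR
  have hyR : y ∈ R := .inr ⟨le_rfl, fun w h1 h2 => by rw [le_antisymm h2 h1, hy]⟩
  have hRd : ∀ z ∈ R, letter η z = d := by
    rintro z (hz | hz)
    exacts [hB z hz, hz.2 z hz.1 le_rfl]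
  have hUR : ∀ u ∈ U, ∀ b ∈ R, u < b := by
    rintro u hu b (hb | hb)
    exacts [hlt u hu b hb, (hUy u hu).trans_le hb.1]
  have hRC : ∀ z ∈ R, z ∉ C := by
    rintro z (hz | hz)
    exacts [hBC z hz, hgC z hz.1]
  have hmid : ∀ z, z ∉ C → z ∉ U → ∀ b ∈ R, z ≤ b → z ∈ R := by
    intro z hz hzU b hb hzb
    by_cases hzy : z < y
    · exact .inl (((hU z).2 ⟨hz, hzy⟩).resolve_left hzU)
    · rcases hb with hb | hb
      · exact absurd (hzb.trans_lt (hBy b hb)) hzy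
      · exact .inr ⟨not_lt.1 hzy, fun w h1 h2 => hb.2 w h1 (h2.trans hzb)⟩
  have hrunR : IsRun η C R := by
    refine IsConstString.isRun ⟨⟨y, hyR⟩, hRC, ?_, ?_⟩ ?_
    · intro a ha b hb z hz h1 h2
      exact hmid z hz (fun hzU => absurd (hUR z hzU a ha) (not_lt.2 h1)) b hb h2
    · exact fun a ha b hb => (hRd a ha).trans (hRd b hb).symm
    · intro z hz hzR
      refine ⟨y, hyR, ?_⟩
      rw [hy]
      by_cases hzU : z ∈ U
      · rcases le_total z a₀ with hle | hle
        · exact ⟨a₀, hUC _ (haU _ ha₀), by rw [hla a₀ ha₀]; simp,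
            .inr ⟨hle, (hUy _ (haU _ ha₀)).le⟩⟩
        · exact ⟨z, hz, by rw [hla z (h.mem_of_le ha₀ hzU hle)]; simp,
            .inr ⟨le_rfl, (hUy _ hzU).le⟩⟩
      · have hyz : y ≤ z := not_lt.1 fun hlt' => hzR (hmid z hz hzU y hyR hlt'.le)
        have : ¬ ∀ w, y ≤ w → w ≤ z → letter η w = d := fun hall => hzR (.inr ⟨hyz, hall⟩)
        push Not at this
        obtain ⟨w, h1, h2, h3⟩ := this
        exact ⟨w, hgC w h1, h3, .inl ⟨h1, h2⟩⟩
  have hsub : insert y B ⊆ R := Set.insert_subset hyR Set.subset_union_left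
  refine ⟨?_, A, R, insert y B, ⟨hrunA, hrunR, ⟨?_, ?_⟩, ?_⟩, ?_, hA, hsub, hBk, ?_, rfl⟩
  · cases d
    · exact ⟨a₀, hUC _ (haU _ ha₀), by simpa using hla a₀ ha₀⟩
    · exact ⟨y, hgC y le_rfl, hy⟩
  · exact fun a ha b hb => hUR a (haU a ha) b hb
  · rintro z hz ⟨a, ha, haz⟩ ⟨b, hb, hzb⟩
    by_cases hzU : z ∈ U
    · exact .inl (h.mem_of_le ha hzU haz)
    · exact .inr (hmid z hz hzU b hb hzb)
  · rw [hA, ← hBk]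
    exact Set.encard_le_encard hsub
  · intro A' B' hcand hne
    rcases hrunR.lt_or_lt hcand.2.1 hne.symm with hlt' | hlt'
    · exact hlt'
    · refine absurd hcand (h.not_isCandidate hUC hini hfol fun b hb => ?_)
      by_contra hbU
      have hb1 := hlt' y hyR b hb
      have hbR := hmid b (hcand.2.1.1.2.1 b hb) hbU y hyR hb1.le
      exact lt_irrefl _ (hlt' b hbR b hb)
  · intro z hz b hb hbn
    rw [Set.mem_insert_iff, not_or] at hbn
    have hyb : y < b := by
      rcases hb with hb | hb
      · exact absurd hb hbn.2
      · exact lt_of_le_of_ne hb.1 (Ne.symm hbn.1)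
    rcases hz with rfl | hz
    exacts [hyb, (hBy z hz).trans hyb]

/-! ### The scan from left to right -/

/-- The state of a scan of the sites up to `x` from left to right in which every soliton is crossed
out as soon as its last site is read: `C` is the set of crossed out sites, the other sites up to
`x` form a stack of runs, and the bits of this stack are the occupied seats of the carrier. -/
structure ScanState (η : ℕ → Bool) (x : ℕ) (C : Set ℤ) : Prop where
  crossed : Crossed η C
  le : ∀ z ∈ C, z ≤ x
  stack : ∃ U T c f, RunStack η U T c f ∧ (∀ z, z ∈ U ↔ z ∉ C ∧ z ≤ x) ∧
    ∀ i, 1 ≤ i → f i = occupied η x i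

theorem scanState_zero (η : ℕ → Bool) : ScanState η 0 ∅ := by
  refine ⟨.start, by simp, Set.Iic 0, Set.Iic 0, false, _, .base ?_ ?_, by simp, ?_⟩
  · exact Set.encard_eq_top (Set.Iic_infinite 0)
  · intro z hz
    rw [letter, if_neg (not_lt.2 hz)]
  · simp [occupied]

theorem letter_natCast_succ (η : ℕ → Bool) (x : ℕ) : letter η ((x : ℤ) + 1) = η (x + 1) := by
  rw [letter, if_pos (by positivity)]
  rfl

theorem ScanState.succ {η : ℕ → Bool} {x : ℕ} {C : Set ℤ} (hs : ScanState η x C) :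
    (∃ k S, 1 ≤ k ∧ Completes η k x ∧ Identifies η C k S ∧ IsGreatest S ((x : ℤ) + 1) ∧
      ScanState η (x + 1) (C ∪ S)) ∨
    ((∀ k, 1 ≤ k → ¬ Completes η k x) ∧ ScanState η (x + 1) C) := by
  obtain ⟨hcr, hle, U, T, c, f, h, hU, hf⟩ := hs
  have hoc : ∀ i, 1 ≤ i → occupied η (x + 1) i = readLetter (η (x + 1)) f i := by
    intro i hi
    have hiff : (∀ l ∈ Finset.Ico 1 i, f l = η (x + 1)) ↔
        ∀ l ∈ Finset.Ico 1 i, occupied η x l = η (x + 1) :=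
      forall₂_congr fun l hl => by rw [hf l (Finset.mem_Ico.1 hl).1]
    rw [occupied, readLetter, readLetter]
    split_ifs with h1 h2 h2
    exacts [rfl, absurd (hiff.2 h1) h2, absurd (hiff.1 h2) h1, (hf i hi).symm]
  have hly := letter_natCast_succ η x
  generalize η (x + 1) = d at hoc hly
  have hxC : ((x : ℤ) + 1) ∉ C := fun hc => by have := hle _ hc; omega
  have hle' : ∀ z ∈ C, z ≤ ((x + 1 : ℕ) : ℤ) := fun z hz => by have := hle z hz; push_cast; omega
  rcases h.top_split d with ⟨rfl, hinf, hzero, rfl⟩ | ⟨U', A, B, f', h', rfl, hB, hlt, hcard, hff⟩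
  · -- only zeros: the infinite run grows
    have hoc' : ∀ i, 1 ≤ i → occupied η (x + 1) i = false := fun i hi => by
      simp [hoc i hi, readLetter]
    refine .inr ⟨fun k hk hcomp => hcomp.1 ?_, hcr, hle', insert ((x : ℤ) + 1) U,
      insert ((x : ℤ) + 1) U, false, _, .base ?_ ?_, ?_, fun i hi => (hoc' i hi).symm⟩
    · rw [hoc' k hk, ← hf k hk]
    · rw [eq_top_iff, ← hinf]
      exact Set.encard_le_encard (Set.subset_insert _ _)
    · rintro z (rfl | hz)
      exacts [hly, hzero z hz]
    · intro z
      rw [Set.mem_insert_iff, hU]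
      push_cast
      refine ⟨?_, fun hz => ?_⟩
      · rintro (rfl | hz)
        exacts [⟨hxC, le_rfl⟩, ⟨hz.1, by omega⟩]
      · by_cases hzx : z = x + 1
        exacts [.inl hzx, .inr ⟨hz.1, by omega⟩]
  · obtain ⟨n, hn⟩ := ENat.ne_top_iff_exists.1 (ne_top_of_lt hcard)
    rw [← hn] at hcard hff
    simp only [Nat.cast_le] at hff
    have hcard' : ((n + 1 : ℕ) : ℕ∞) ≤ A.encard := by
      push_cast
      exact Order.add_one_le_of_lt hcard
    have hn1 : f' (n + 1) = !d := h'.bit_eq hcard'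
    have hnew : ∀ i, 1 ≤ i → occupied η (x + 1) i = if i ≤ n + 1 then d else f' i := fun i hi => by
      rw [hoc i hi, bits_step hff hn1 hi]
    have hold : ∀ i, 1 ≤ i → occupied η x i = if i ≤ n then d else f' i := fun i hi => by
      rw [← hf i hi, hff i hi]
    have hyB : ((x : ℤ) + 1) ∉ B := fun hb => by have := ((hU _).1 (.inr hb)).2; omega
    have hBn : (insert ((x : ℤ) + 1) B).encard = ((n + 1 : ℕ) : ℕ∞) := by
      rw [Set.encard_insert_of_notMem hyB, ← hn]
      norm_cast
    rcases hcard'.lt_or_eq with hlt' | heq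
    · -- the string `B` stays shorter than the run `A`
      right
      refine ⟨fun k hk hcomp => ?_, hcr, hle', U' ∪ insert ((x : ℤ) + 1) B,
        insert ((x : ℤ) + 1) B, d, fun i => if i ≤ n + 1 then d else f' i, ?_, ?_,
        fun i hi => (hnew i hi).symm⟩
      · have hkn : k = n + 1 := by
          have := hcomp.1
          rw [hnew k hk, hold k hk] at this
          split_ifs at this <;> first | omega | exact absurd rfl this
        subst hkn
        have h2 := hcomp.2
        have hn2 : f' (n + 1 + 1) = !d := by
          refine h'.bit_eq ?_
          rw [Nat.cast_add_one]
          exact Order.add_one_le_of_lt hlt'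
        rw [hnew _ (by omega), hnew _ hk, if_neg (by omega), if_pos le_rfl, hn2] at h2
        simp at h2
      · have hpush := h'.push (B := insert ((x : ℤ) + 1) B) (Set.insert_nonempty _ _) ?_ ?_
          (hBn ▸ hlt')
        · simpa only [Bool.not_not, hBn, Nat.cast_le] using hpush
        · rw [Bool.not_not]
          rintro b (rfl | hb)
          exacts [hly, hB b hb]
        · rintro u hu b (rfl | hb)
          · have := ((hU u).1 (.inl hu)).2
            omega
          · exact hlt u hu b hb
      · intro z
        have hz := hU z
        rw [Set.mem_union] at hz
        rw [Set.mem_union, Set.mem_insert_iff, or_left_comm, hz]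
        push_cast
        refine ⟨?_, fun hz => ?_⟩
        · rintro (rfl | hz)
          exacts [⟨hxC, le_rfl⟩, ⟨hz.1, by omega⟩]
        · by_cases hzx : z = x + 1
          exacts [.inl hzx, .inr ⟨hz.1, by omega⟩]
    · -- the string `B` becomes as long as the run `A`, and both are crossed out
      left
      have hid : Identifies η C (n + 1) (A ∪ insert ((x : ℤ) + 1) B) := by
        refine h'.identifies hB hlt (fun z => ?_) (fun z hz => ?_) hly heq.symm hBn
        · rw [hU, Int.lt_add_one_iff]
        · exact Int.lt_add_one_iff.2 (hle z hz)
      have hAx : ∀ a ∈ A, a ≤ x := fun a ha => ((hU a).1 (.inl (h'.subset ha))).2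
      have hBx : ∀ b ∈ B, b ≤ x := fun b hb => ((hU b).1 (.inr hb)).2
      have hgr : IsGreatest (A ∪ insert ((x : ℤ) + 1) B) ((x : ℤ) + 1) := by
        refine ⟨.inr (Set.mem_insert _ _), ?_⟩
        rintro z (hz | rfl | hz)
        · have := hAx z hz
          omega
        · exact le_rfl
        · have := hBx z hz
          omega
      generalize hd' : (!d) = d' at h' hn1
      cases h' with
      | base hinf _ =>
        rw [hinf] at heq
        exact absurd heq (ENat.natCast_ne_top _)
      | @push V A' _ c g hV hA hlet hVA hcA =>
        have hcd : c = d := by cases c <;> cases d <;> simp_all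
        subst hcd
        rw [← heq] at hcA hnew hold
        simp only [Nat.cast_le] at hnew hold
        have hg : ∀ i, i ≤ n + 1 + 1 → g i = c := by
          intro i hi
          refine hV.bit_eq ((Nat.cast_le.2 hi).trans ?_)
          rw [Nat.cast_add_one]
          exact Order.add_one_le_of_lt hcA
        have hnew' : ∀ i, 1 ≤ i → occupied η (x + 1) i = g i := by
          intro i hi
          rw [hnew i hi]
          split_ifs with hi'
          exacts [(hg i (by omega)).symm, rfl]
        refine ⟨n + 1, _, by omega, ⟨?_, ?_⟩, hid, hgr, hcr.cross hid, ?_, V, A', c, g, hV, ?_,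
          fun i hi => (hnew' i hi).symm⟩
        · rw [hnew' _ (by omega), hg _ (by omega), hold _ (by omega), if_neg (by omega),
            if_pos le_rfl]
          simp
        · rw [hnew' _ (by omega), hnew' _ (by omega), hg _ (by omega), hg _ (by omega)]
        · rintro z (hz | hz)
          · exact hle' z hz
          · exact_mod_cast hgr.2 hz
        · intro z
          have hz := hU z
          simp only [Set.mem_union, Set.mem_insert_iff] at hz ⊢
          push_cast
          constructor
          · intro hzV
            have hz1 := hz.1 (.inl (.inl hzV))
            refine ⟨?_, by omega⟩
            rintro (hzC | hzA | hzx | hzB)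
            · exact hz1.1 hzC
            · exact lt_irrefl _ (hVA z hzV z hzA)
            · omega
            · exact lt_irrefl _ (hlt z (.inl hzV) z hzB)
          · rintro ⟨hzn, hzx⟩
            push Not at hzn
            have := hz.2 ⟨hzn.1, by have := hzn.2.2.1; omega⟩
            tauto

/-! ### Solitons and completed seats -/

theorem exists_scanState (η : ℕ → Bool) (x : ℕ) : ∃ C, ScanState η x C := by
  induction x with
  | zero => exact ⟨∅, scanState_zero η⟩
  | succ x ih =>
    obtain ⟨C, hC⟩ := ih
    rcases hC.succ with ⟨k, S, -, -, -, -, h⟩ | ⟨-, h⟩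
    exacts [⟨_, h⟩, ⟨_, h⟩]

/-- As long as there is an uncrossed ball, the scan crosses out another soliton: otherwise
the zeros after the last ball would pile up to a run longer than the number of balls. -/
theorem ScanState.not_forall {η : ℕ → Bool} (hη : η ∈ FiniteConfig) {n : ℕ} {C : Set ℤ}
    (hball : ∃ z, z ∉ C ∧ letter η z = true) (h : ∀ m, n ≤ m → ScanState η m C) : False := by
  obtain ⟨z₀, hz₀C, hz₀⟩ := hball
  have hinj : Set.InjOn Int.toNat {z : ℤ | letter η z = true} := by
    intro a ha b hb hab
    simp only [Set.mem_ofPred_eq, letter] at ha hb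
    split_ifs at ha hb
    omega
  have hfin : {z : ℤ | letter η z = true}.Finite := by
    refine Set.Finite.of_finite_image (hη.2.subset ?_) hinj
    rintro _ ⟨z, hz, rfl⟩
    simp only [Set.mem_ofPred_eq, letter] at hz ⊢
    split_ifs at hz
    exact hz
  obtain ⟨M, hM⟩ := hfin.bddAbove
  obtain ⟨m, hnm, hMm⟩ : ∃ m : ℕ, n ≤ m ∧ M ≤ m :=
    ⟨max n M.toNat, le_max_left _ _, (Int.self_le_toNat M).trans (by simp)⟩
  have hzero : ∀ z : ℤ, (m : ℤ) < z → letter η z = false := fun z hz => by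
    by_contra hne
    have := hM (show letter η z = true by simpa using hne)
    omega
  -- the zeros in `(m, m + N]` outnumber the balls
  set N := {z : ℤ | letter η z = true}.ncard + 1 with hN
  obtain ⟨-, -, U, T, c, f, hst, hU, -⟩ := h (m + N) (by omega)
  have hCm := (h m hnm).le
  have htop : (((m + N : ℕ) : ℤ)) ∈ U := (hU _).2
    ⟨fun hc => by have := hCm _ hc; push_cast at this; omega, le_rfl⟩
  have htopT : (((m + N : ℕ) : ℤ)) ∈ T := by
    obtain ⟨t, ht⟩ := hst.nonempty
    exact hst.mem_of_le ht htop ((hU t).1 (hst.subset ht)).2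
  have hc : c = false := by
    rw [← hst.letter_eq _ htopT]
    exact hzero _ (by push_cast; omega)
  subst hc
  have hz₀U : z₀ ∈ U := (hU z₀).2 ⟨hz₀C, by have := hM hz₀; push_cast; omega⟩
  generalize hd : false = d at hst
  cases hst with
  | base _ hR => rw [hR z₀ hz₀U] at hz₀; exact Bool.noConfusion hz₀
  | @push V A _ c' g hV hB hlet hVB hcard =>
    obtain rfl : c' = true := by simpa using hd.symm
    have hA : ∀ a ∈ A, letter η a = true := hV.letter_eq
    have hsub : Set.Ioc (m : ℤ) (m + N : ℕ) ⊆ T := by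
      intro z hz
      have hzU : z ∈ V ∪ T := (hU z).2 ⟨fun hc => by have := hCm z hc; have := hz.1; omega, hz.2⟩
      refine hzU.resolve_left fun hzV => ?_
      obtain ⟨a, ha⟩ := hV.nonempty
      have ham := hM (hA a ha)
      have hzA := hV.mem_of_le ha hzV (by have := hz.1; omega)
      have h1 := hA z hzA
      rw [hzero z hz.1] at h1
      exact Bool.noConfusion h1
    have h1 : A.encard ≤ ({z : ℤ | letter η z = true}.ncard : ℕ∞) := by
      rw [hfin.cast_ncard_eq]
      exact Set.encard_le_encard hA
    have h2 : (N : ℕ∞) ≤ T.encard := by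
      refine le_trans ?_ (Set.encard_le_encard hsub)
      rw [← Set.Finite.cast_ncard_eq (Set.finite_Ioc _ _), ← Finset.coe_Ioc,
        Set.ncard_coe_finset, Int.card_Ioc]
      simp
    have h3 := (h2.trans_lt hcard).trans_le h1
    rw [Nat.cast_lt] at h3
    omega

/-- What the algorithm identifies is the next soliton of the scan. -/
theorem ScanState.exists_of_identifies {η : ℕ → Bool} (hη : η ∈ FiniteConfig) {n k : ℕ}
    {C S : Set ℤ} (h : ScanState η n C) (hid : Identifies η C k S) :
    ∃ m, 1 ≤ k ∧ Completes η k m ∧ IsGreatest S ((m : ℤ) + 1) ∧ ScanState η (m + 1) (C ∪ S) := by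
  by_contra hcon
  refine ScanState.not_forall hη hid.1 (n := n) fun m hnm => ?_
  induction m, hnm using Nat.le_induction with
  | base => exact h
  | succ m _ ih =>
    rcases ih.succ with ⟨k', S', hk', hcomp, hid', hgr, hs⟩ | ⟨-, hs⟩
    · obtain ⟨rfl, rfl⟩ := hid.unique hid'
      exact absurd ⟨m, hk', hcomp, hgr, hs⟩ hcon
    · exact hs

theorem Crossed.exists_scanState {η : ℕ → Bool} (hη : η ∈ FiniteConfig) {C : Set ℤ}
    (h : Crossed η C) : ∃ n, ScanState η n C := by
  induction h with
  | start => exact ⟨0, scanState_zero η⟩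
  | cross _ hid ih =>
    obtain ⟨n, hn⟩ := ih
    obtain ⟨m, -, -, -, hm⟩ := hn.exists_of_identifies hη hid
    exact ⟨m + 1, hm⟩

theorem exists_isSoliton_iff {η : ℕ → Bool} (hη : η ∈ FiniteConfig) {k : ℕ} (hk : 1 ≤ k) (x : ℕ) :
    (∃ S, IsSoliton η k S ∧ IsGreatest S ((x : ℤ) + 1)) ↔ Completes η k x := by
  constructor
  · rintro ⟨S, ⟨C, hC, hid⟩, hgr⟩
    obtain ⟨n, hn⟩ := hC.exists_scanState hη
    obtain ⟨m, -, hcomp, hgr', -⟩ := hn.exists_of_identifies hη hid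
    have := hgr.unique hgr'
    obtain rfl : x = m := by omega
    exact hcomp
  · intro hcomp
    obtain ⟨C, hC⟩ := exists_scanState η x
    rcases hC.succ with ⟨k', S, hk', hcomp', hid, hgr, -⟩ | ⟨hno, -⟩
    · obtain rfl := hcomp.unique hk hk' hcomp'
      exact ⟨S, ⟨C, hC.crossed, hid⟩, hgr⟩
    · exact absurd hcomp (hno k hk)

end BBS

theorem proposition4p3 (η : ℕ → Bool) (hη : η ∈ BBS.FiniteConfig) (k : ℕ) (hk : 1 ≤ k)
    (x : ℕ) (hx : 1 ≤ x) :
    (∃ S : Set ℤ, BBS.IsSoliton η k S ∧ IsGreatest S (x : ℤ)) ↔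
      ∃ j : ℕ, 1 ≤ j ∧ (x : ℕ∞) = BBS.tau η k j := by
  obtain ⟨x, rfl⟩ := Nat.exists_eq_add_of_le' hx
  rw [BBS.exists_eq_tau_iff η hk, ← BBS.exists_isSoliton_iff hη hk]
  push_cast
  rfl
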